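/- Let $n\ge 2$ be an integer and $p>n$ a real number. Let $\mathbb{B}^n$ be the open unit ball of $\mathbb{R}^n$, put $S_r=\{x\in\mathbb{R}^n:|x|=r\}$, and let $Q:\mathbb{B}^n\to[0,\infty]$ be Lebesgue measurable. For a family $\Gamma$ of curves in $\mathbb{R}^n$ let $M_p(\Gamma)=\inf_\rho\int_{\mathbb{R}^n}\rho^p\,dm$ be its $p$-modulus, where the infimum is over all Borel functions $\rho:\mathbb{R}^n\to[0,\infty]$ with $\int_\gamma\rho\,ds\ge 1$ for every locally rectifiable $\gamma\in\Gamma$, and $m$ is Lebesgue measure. Let $\Delta(E,F,G)$ be the family of all continuous curves $\gamma:[a,b]\to\mathbb{R}^n$ with $\gamma(a)\in E$, $\gamma(b)\in F$ and $\gamma(t)\in G$ for $a<t<b$. Let $f$ be a homeomorphism of $\mathbb{B}^n$ onto its image $f\mathbb{B}^n\subset\mathbb{R}^n$ with $f(0)=0$, and suppose that $f$ is a ring $Q$-homeomorphism with respect to $p$-modulus at $0$, that is, $$M_p\bigl(\Delta(fS_{r_1},fS_{r_2},f\mathbb{B}^n)\bigr)\le\int_{\{r_1<|x|<r_2\}}Q(x)\,\eta^p(|x|)\,dm(x)$$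 for all $0<r_1<r_2<1$ and all measurable $\eta:(r_1,r_2)\to[0,\infty]$ with $\int_{r_1}^{r_2}\eta(r)\,dr=1$. Let $q_0\in(0,\infty)$ and $\varepsilon_0\in(0,1)$, and assume that the spherical means of $Q$ satisfy $$\frac{1}{\omega_{n-1}t^{n-1}}\int_{S_t}Q\,d\mathcal{A}\le q_0\qquad\text{for a.e. }t\in(0,\varepsilon_0),$$ where $\omega_{n-1}$ is the area of the unit sphere and $d\mathcal{A}$ is the element of surface area. Then $$\limsup_{x\to 0}\frac{|f(x)|}{|x|}\ge q_0^{\frac{1}{n-p}},$$ where the upper limit may be $+\infty$. -/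

import Mathlib

open MeasureTheory Set Filter Topology
open scoped ENNReal

/-- Euclidean space `ℝⁿ`. -/
abbrev Rn (n : ℕ) : Type := EuclideanSpace ℝ (Fin n)

/-- A curve in `ℝⁿ`: a continuous map `γ : [a, b] → ℝⁿ` on a compact interval (the values of
`toFun` outside `[a, b]` are irrelevant). -/
structure Curve (n : ℕ) where
  a : ℝ
  b : ℝ
  hab : a < b
  toFun : ℝ → Rn n
  continuousOn : ContinuousOn toFun (Icc a b)

namespace Curve

/-- The length of a curve, i.e. its total variation over `[a, b]`. -/
noncomputable def length {n : ℕ} (γ : Curve n) : ℝ≥0∞ :=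
  eVariationOn γ.toFun (Icc γ.a γ.b)

/-- A curve is rectifiable if its length is finite.  (For curves on compact intervals, local
rectifiability is the same as rectifiability.) -/
def Rectifiable {n : ℕ} (γ : Curve n) : Prop := γ.length ≠ ∞

/-- The line integral `∫_γ ρ ds = ∫_0^ℓ ρ(γ⁰(s)) ds` of a function `ρ ≥ 0` along a rectifiable
curve `γ` of length `ℓ`, where `γ⁰` is the parametrization of `γ` by arc length. -/
noncomputable def lineIntegral {n : ℕ} (γ : Curve n) (ρ : Rn n → ℝ≥0∞) : ℝ≥0∞ :=
  ∫⁻ s in Icc 0 γ.length.toReal, ρ (naturalParameterization γ.toFun (Icc γ.a γ.b) γ.a s)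

end Curve

/-- `ρ` is admissible for the family `Γ`: it is Borel measurable, and its line integral along each
(locally) rectifiable curve of `Γ` is at least one. -/
def Admissible {n : ℕ} (Γ : Set (Curve n)) (ρ : Rn n → ℝ≥0∞) : Prop :=
  Measurable ρ ∧ ∀ γ ∈ Γ, γ.Rectifiable → 1 ≤ γ.lineIntegral ρ

/-- The `p`-modulus `M_p(Γ)` of a family of curves. -/
noncomputable def pModulus {n : ℕ} (p : ℝ) (Γ : Set (Curve n)) : ℝ≥0∞ :=
  ⨅ (ρ : Rn n → ℝ≥0∞) (_ : Admissible Γ ρ), ∫⁻ x, ρ x ^ p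

/-- `Δ(E, F, G)`: the family of all curves `γ : [a, b] → ℝⁿ` with `γ(a) ∈ E`, `γ(b) ∈ F` and
`γ(t) ∈ G` for `a < t < b`. -/
def joiningCurves {n : ℕ} (E F G : Set (Rn n)) : Set (Curve n) :=
  {γ | γ.toFun γ.a ∈ E ∧ γ.toFun γ.b ∈ F ∧ ∀ t ∈ Ioo γ.a γ.b, γ.toFun t ∈ G}

/-- The open spherical ring `𝔸(x₀, r₁, r₂) = {x : r₁ < |x - x₀| < r₂}`. -/
def sphericalRing {n : ℕ} (x₀ : Rn n) (r₁ r₂ : ℝ) : Set (Rn n) :=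
  {x | r₁ < ‖x - x₀‖ ∧ ‖x - x₀‖ < r₂}

/-- `f`, considered on the domain `D`, is a ring `Q`-homeomorphism with respect to the `p`-modulus
at the point `x₀ ∈ D`.  Only the values of `f` and `Q` on `D` matter; the distance
`d₀ = dist(x₀, ∂D)` is infinite if `∂D` is empty. -/
structure IsRingQHomeomorphism {n : ℕ} (p : ℝ) (D : Set (Rn n)) (Q : Rn n → ℝ≥0∞) (x₀ : Rn n)
    (f : Rn n → Rn n) : Prop where
  /-- The centre is a point of the domain. -/
  mem : x₀ ∈ D
  /-- `Q` is Lebesgue measurable on `D`. -/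
  measurable : AEMeasurable Q (volume.restrict D)
  /-- `f` is a homeomorphism of `D` onto its image. -/
  homeo : IsEmbedding (D.domRestrict f)
  /-- The modulus inequality, for all rings and all measurable `η ≥ 0` of integral one. -/
  modulus_le : ∀ r₁ r₂ : ℝ, 0 < r₁ → r₁ < r₂ →
    ENNReal.ofReal r₂ < Metric.infEDist x₀ (frontier D) →
    ∀ η : ℝ → ℝ≥0∞, AEMeasurable η (volume.restrict (Ioo r₁ r₂)) →
      ∫⁻ r in Ioo r₁ r₂, η r = 1 →
      pModulus p (joiningCurves (f '' Metric.sphere x₀ r₁) (f '' Metric.sphere x₀ r₂) (f '' D)) ≤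
        ∫⁻ x in sphericalRing x₀ r₁ r₂, Q x * η ‖x - x₀‖ ^ p

/-- The area measure of the sphere `S(x₀, r)`, `r > 0`: the image of the area measure of the unit
sphere under `u ↦ x₀ + r u`, multiplied by `r ^ (n - 1)`. -/
noncomputable def sphereArea {n : ℕ} (x₀ : Rn n) (r : ℝ) : Measure (Rn n) :=
  ENNReal.ofReal (r ^ (n - 1)) •
    (volume : Measure (Rn n)).toSphere.map
      (fun u : Metric.sphere (0 : Rn n) 1 => x₀ + r • (u : Rn n))

/-- The area `ω_{n-1}` of the unit sphere in `ℝⁿ`. -/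
noncomputable def unitSphereArea (n : ℕ) : ℝ≥0∞ :=
  (volume : Measure (Rn n)).toSphere univ

/-- The mean `q_{x₀}(r) = (ω_{n-1} r^{n-1})⁻¹ ∫_{S(x₀, r)} Q d𝒜` of `Q` over the sphere
`S(x₀, r)`, `r > 0`. -/
noncomputable def sphericalMean {n : ℕ} (Q : Rn n → ℝ≥0∞) (x₀ : Rn n) (r : ℝ) : ℝ≥0∞ :=
  (unitSphereArea n * ENNReal.ofReal (r ^ (n - 1)))⁻¹ * ∫⁻ x, Q x ∂(sphereArea x₀ r)

/-! Suppose |f(x)| ≤ k|x| near 0 with k < q₀^{1/(n-p)}, and put α = (p-n)/(p-1) > 0. Every ray from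
0 contains a segment joining f S_{r₁} to f S_r inside the ball of radius kr. Hölder on each ray and
integration over directions (`le_pModulus_of_forall_radialCurve_mem`) bound the modulus of the
joining curves below by ω_{n-1} α^{p-1} (kr)^{n-p}. The ring inequality with η proportional to
t^{α-1} (`pModulus_joiningCurves_le`) bounds it above by ω_{n-1} q₀ ((r^α - r₁^α)/α)^{1-p}. As r₁ →
0 the powers of r cancel and k^{n-p} ≤ q₀ remains; since n-p < 0, this contradicts the choice of k.

The segments exist because a ray leaving the bounded set f(B_r) does so through f(S_r), which
requires f(B_r) to be open. That is invariance of domain, derived from a form of Brouwer's theorem,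
which in turn rests on the invariance of the total Jacobian under compactly supported perturbations
of the identity (`integral_det_id_add_fderiv`). -/

/-! ### The total Jacobian. -/

section TotalJacobian

variable {E : Type*} [NormedAddCommGroup E] [InnerProductSpace ℝ E] [FiniteDimensional ℝ E]
  [MeasurableSpace E] [BorelSpace E]

/-- For `s` large, `x ↦ s x + g x` maps the ball onto its dilation, and its Jacobian is positive. -/
theorem exists_forall_integral_det_smul_add_fderiv {g : E → E} (hg : ContDiff ℝ 1 g) {R : ℝ}
    (hR : ∀ x, R ≤ ‖x‖ → g x = 0) :
    ∃ S : ℝ, ∀ s, S ≤ s →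
      ∫ x in Metric.ball (0 : E) R, (s • ContinuousLinearMap.id ℝ E + fderiv ℝ g x).det =
        s ^ Module.finrank ℝ E * volume.real (Metric.ball (0 : E) R) := by
  have hcs : HasCompactSupport g := by
    apply HasCompactSupport.of_support_subset_isCompact (isCompact_closedBall (0 : E) R)
    intro x hx
    by_contra h
    simp only [Metric.mem_closedBall, dist_zero_right, not_le] at h
    exact hx (hR x h.le)
  obtain ⟨K, hK⟩ := hg.lipschitzWith_of_hasCompactSupport hcs one_ne_zero
  obtain ⟨δ, hδ, hdet⟩ : ∃ δ > 0, ∀ B : E →L[ℝ] E,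
      ‖B - ContinuousLinearMap.id ℝ E‖ < δ → 0 < B.det := by
    have h1 : ∀ᶠ B : E →L[ℝ] E in 𝓝 (ContinuousLinearMap.id ℝ E), 0 < B.det := by
      apply (ContinuousLinearMap.continuous_det (𝕜 := ℝ) (E := E)).continuousAt.eventually
      apply lt_mem_nhds
      simp [ContinuousLinearMap.det]
    obtain ⟨δ, hδ, h⟩ := Metric.eventually_nhds_iff.1 h1
    exact ⟨δ, hδ, fun B hB => h (by rwa [dist_eq_norm])⟩
  -- The first bound makes s⁻¹ g a 1/2-Lipschitz map, so that id + s⁻¹ g is bijective; the second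
  -- gives K / s < δ, so that its Jacobian is positive.
  refine ⟨max (2 * K + 1) ((K + 1) / δ), fun s hs => ?_⟩
  have hs1 : 2 * (K : ℝ) + 1 ≤ s := (le_max_left _ _).trans hs
  have hs2 : ((K : ℝ) + 1) / δ ≤ s := (le_max_right _ _).trans hs
  have hK0 : (0 : ℝ) ≤ K := K.2
  have hs0 : 0 < s := by linarith
  have hsδ : (K : ℝ) / s < δ := by
    rw [div_le_iff₀ hδ] at hs2
    rw [div_lt_iff₀ hs0]; linarith
  set h : E → E := fun x => x + s⁻¹ • g x with hh
  have hgd : Differentiable ℝ g := hg.differentiable one_ne_zero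
  have hder : ∀ x, HasFDerivAt h (ContinuousLinearMap.id ℝ E + s⁻¹ • fderiv ℝ g x) x := fun x =>
    (hasFDerivAt_id x).add ((hgd x).hasFDerivAt.const_smul s⁻¹)
  have happ : ApproximatesLinearOn h
      ((ContinuousLinearEquiv.refl ℝ E : E ≃L[ℝ] E) : E →L[ℝ] E) univ (1 / 2) := by
    intro x _ y _
    have : h x - h y - (x - y) = s⁻¹ • (g x - g y) := by simp only [hh, smul_sub]; abel
    simp only [ContinuousLinearEquiv.coe_refl, ContinuousLinearMap.coe_id', id]
    rw [this, norm_smul, norm_inv, Real.norm_of_nonneg hs0.le]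
    have h1 : ‖g x - g y‖ ≤ K * ‖x - y‖ := by simpa [dist_eq_norm] using hK.dist_le_mul x y
    calc s⁻¹ * ‖g x - g y‖ ≤ s⁻¹ * (K * ‖x - y‖) := by gcongr
      _ = (s⁻¹ * K) * ‖x - y‖ := by ring
      _ ≤ ((1 / 2 : NNReal) : ℝ) * ‖x - y‖ := by
        gcongr
        rw [inv_mul_le_iff₀ hs0]; push_cast; linarith
  have hc : Subsingleton E ∨ (1 / 2 : NNReal) <
      ‖(((ContinuousLinearEquiv.refl ℝ E).symm : E ≃L[ℝ] E) : E →L[ℝ] E)‖₊⁻¹ := by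
    rcases subsingleton_or_nontrivial E with hE | hE
    · exact Or.inl hE
    · right
      simp only [ContinuousLinearEquiv.refl_symm, ContinuousLinearEquiv.coe_refl]
      rw [ContinuousLinearMap.nnnorm_id, inv_one]
      exact NNReal.half_lt_self one_ne_zero
  have hinj : Function.Injective h := injOn_univ.1 (happ.injOn hc)
  have hsurj : Function.Surjective h := happ.surjective hc
  have hfix : ∀ x, R ≤ ‖x‖ → h x = x := fun x hx => by simp [hh, hR x hx]
  -- A bijection that is the identity outside the ball maps the ball onto itself.
  have himg : h '' Metric.ball 0 R = Metric.ball 0 R := by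
    ext y
    simp only [mem_image, mem_ball_zero_iff]
    constructor
    · rintro ⟨x, hx, rfl⟩
      by_contra hy
      rw [not_lt] at hy
      have := hinj (hfix _ hy)
      rw [this] at hy
      linarith
    · intro hy
      obtain ⟨x, rfl⟩ := hsurj y
      refine ⟨x, ?_, rfl⟩
      by_contra hx
      rw [not_lt] at hx
      rw [hfix x hx] at hy
      linarith
  have hdetpos : ∀ x, 0 < (ContinuousLinearMap.id ℝ E + s⁻¹ • fderiv ℝ g x).det := by
    intro x
    apply hdet
    rw [add_sub_cancel_left, norm_smul, norm_inv, Real.norm_of_nonneg hs0.le]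
    refine lt_of_le_of_lt ?_ hsδ
    rw [div_eq_inv_mul]
    gcongr
    exact norm_fderiv_le_of_lipschitz ℝ hK
  have hcv := integral_image_eq_integral_abs_det_fderiv_smul (volume : Measure E)
    (measurableSet_ball (x := (0 : E)) (ε := R)) (fun x _ => (hder x).hasFDerivWithinAt)
    hinj.injOn (fun _ => (1 : ℝ))
  rw [himg] at hcv
  simp only [integral_const, smul_eq_mul, mul_one, measureReal_restrict_apply_univ] at hcv
  rw [hcv, ← integral_const_mul]
  congr 1
  ext x
  rw [abs_of_pos (hdetpos x), ContinuousLinearMap.det, ContinuousLinearMap.det,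
    ← LinearMap.det_smul]
  congr 1
  ext v
  simp [smul_smul, hs0.ne']

/-- The total Jacobian of a compactly supported perturbation of the identity. -/
theorem integral_det_id_add_fderiv {g : E → E} (hg : ContDiff ℝ 1 g) {R : ℝ}
    (hR : ∀ x, R ≤ ‖x‖ → g x = 0) :
    ∫ x in Metric.ball (0 : E) R, (ContinuousLinearMap.id ℝ E + fderiv ℝ g x).det =
      volume.real (Metric.ball (0 : E) R) := by
  obtain ⟨S, hS⟩ := exists_forall_integral_det_smul_add_fderiv hg hR
  set N := Module.finrank ℝ E
  set v : ℕ → ℝ := fun j => S + j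
  have hv : Set.InjOn v (Finset.range (N + 1)) := fun i _ j _ hij => by simpa [v] using hij
  -- On polynomials of degree at most N, evaluation at 1 is a fixed combination of evaluations at N
  -- + 1 nodes. Since det(s id + A) is such a polynomial in s, the identity known for large s
  -- carries down to s = 1.
  have hint : ∀ p : Polynomial ℝ, p.natDegree ≤ N →
      p.eval 1 = ∑ j ∈ Finset.range (N + 1),
        (Lagrange.basis (Finset.range (N + 1)) v j).eval 1 * p.eval (v j) := by
    intro p hp
    have h1 : p.degree < (Finset.range (N + 1)).card := by
      rw [Finset.card_range]
      exact Polynomial.degree_le_natDegree.trans_lt (by exact_mod_cast Nat.lt_succ_of_le hp)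
    conv_lhs => rw [Lagrange.eq_interpolate hv h1]
    rw [Lagrange.interpolate_apply, Polynomial.eval_finsetSum]
    simp [mul_comm]
  have hchar : ∀ (A : E →L[ℝ] E) (s : ℝ), (s • ContinuousLinearMap.id ℝ E + A).det =
      ((-A : E →L[ℝ] E) : E →ₗ[ℝ] E).charpoly.eval s := by
    intro A s
    rw [LinearMap.eval_charpoly, ContinuousLinearMap.det]
    congr 1
    ext v
    simp [Module.algebraMap_end_apply]
  have hcont : ∀ s : ℝ, Integrable (fun x => (s • ContinuousLinearMap.id ℝ E + fderiv ℝ g x).det)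
      (volume.restrict (Metric.ball (0 : E) R)) := by
    intro s
    have hc : Continuous fun x => (s • ContinuousLinearMap.id ℝ E + fderiv ℝ g x).det :=
      ContinuousLinearMap.continuous_det.comp
        (continuous_const.add (hg.continuous_fderiv one_ne_zero))
    exact (hc.continuousOn.integrableOn_compact (isCompact_closedBall (0 : E) R)).mono_set
      Metric.ball_subset_closedBall
  have key : ∀ x, (ContinuousLinearMap.id ℝ E + fderiv ℝ g x).det =
      ∑ j ∈ Finset.range (N + 1), (Lagrange.basis (Finset.range (N + 1)) v j).eval 1 *
        (v j • ContinuousLinearMap.id ℝ E + fderiv ℝ g x).det := by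
    intro x
    have h1 := hint (((-fderiv ℝ g x : E →L[ℝ] E) : E →ₗ[ℝ] E).charpoly)
      (LinearMap.charpoly_natDegree _).le
    simp only [← hchar, one_smul] at h1
    exact h1
  simp only [key]
  rw [integral_finsetSum _ fun j _ => (hcont (v j)).const_mul _]
  have h2 : ∀ j ∈ Finset.range (N + 1), ∫ x in Metric.ball (0 : E) R,
      (Lagrange.basis (Finset.range (N + 1)) v j).eval 1 *
        (v j • ContinuousLinearMap.id ℝ E + fderiv ℝ g x).det =
      (Lagrange.basis (Finset.range (N + 1)) v j).eval 1 * v j ^ N *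
        volume.real (Metric.ball (0 : E) R) := by
    intro j _
    rw [integral_const_mul, hS (v j) (by simp [v]), mul_assoc]
  rw [Finset.sum_congr rfl h2, ← Finset.sum_mul]
  -- The same formula for X^N: the weights times v j ^ N sum to 1.
  have h3 := hint (Polynomial.X ^ N) (by simp)
  simp only [Polynomial.eval_pow, Polynomial.eval_X, one_pow] at h3
  rw [← h3, one_mul]

end TotalJacobian

/-! ### Brouwer's theorem. -/

section Zeros

variable {E : Type*} [NormedAddCommGroup E] [InnerProductSpace ℝ E] [FiniteDimensional ℝ E]

/-- A map of constant nonzero norm near a point has singular derivative there. -/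
theorem det_eq_zero_of_norm_eventually_const {H : E → E} {A : E →L[ℝ] E} {x : E} {c : ℝ}
    (hc : c ≠ 0) (hA : HasFDerivAt H A x) (hn : ∀ᶠ y in 𝓝 x, ‖H y‖ = c) : A.det = 0 := by
  have h1 : HasFDerivAt (fun y => ‖H y‖ ^ 2) (2 • (innerSL ℝ (H x)).comp A) x := hA.norm_sq
  have h2 : HasFDerivAt (fun y => ‖H y‖ ^ 2) (0 : E →L[ℝ] ℝ) x :=
    (hasFDerivAt_const (c ^ 2) x).congr_of_eventuallyEq (hn.mono fun y hy => by simp [hy])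
  have h3 := h1.unique h2
  by_contra hdet
  have hu : IsUnit (LinearMap.det (A : E →ₗ[ℝ] E)) := isUnit_iff_ne_zero.2 hdet
  have hbij := (Module.End.isUnit_iff _).1 ((LinearMap.isUnit_iff_isUnit_det _).2 hu)
  -- Differentiating the squared norm gives ⟨H x, A v⟩ = 0 for all v; taking A v = H x forces H x =
  -- 0.
  obtain ⟨v, hv⟩ := hbij.2 (H x)
  have h4 := congrArg (fun L : E →L[ℝ] ℝ => L v) h3
  simp only [ContinuousLinearMap.coe_coe] at hv
  simp [hv] at h4
  have h5 := hn.self_of_nhds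
  rw [h4] at h5
  simp at h5
  exact hc h5.symm

/-- Without zeros, h/|h| can be blended with the identity into a C¹ map H that has norm 1 on the
unit ball and is the identity beyond radius 2. Its Jacobian vanishes in the open unit ball. On the
annulus A between the radii 1 and 2, H moves points along rays and maps A injectively into itself,
so the total Jacobian is at most vol A. By `integral_det_id_add_fderiv` it equals the volume of the
whole ball of radius 2, which is larger. -/
theorem exists_zero_of_contDiff_of_eq_id [Nontrivial E] {h : E → E} (hh : ContDiff ℝ 1 h)
    (hid : ∀ x, 1 ≤ ‖x‖ → h x = x) : ∃ x, h x = 0 := by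
  by_contra! hne
  borelize E
  set χ : E → ℝ := fun x => Real.smoothTransition ((‖x‖ ^ 2 - 1) / 3) with hχ
  have hχs : ContDiff ℝ 1 χ := by
    have h1 : ContDiff ℝ 1 (fun x : E => (‖x‖ ^ 2 - 1) / 3) :=
      ((contDiff_norm_sq ℝ).sub contDiff_const).div_const _
    exact Real.smoothTransition.contDiff.comp h1
  set H : E → E := fun x => χ x • x + (1 - χ x) • (‖h x‖⁻¹ • h x) with hH
  have hHs : ContDiff ℝ 1 H := by
    refine (hχs.smul contDiff_id).add ((contDiff_const.sub hχs).smul ?_)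
    exact ((hh.norm ℝ hne).inv fun x => norm_ne_zero_iff.2 (hne x)).smul hh
  have hHd : Differentiable ℝ H := hHs.differentiable one_ne_zero
  have hχ0 : ∀ x, ‖x‖ ≤ 1 → χ x = 0 := fun x hx =>
    Real.smoothTransition.zero_of_nonpos (by nlinarith [norm_nonneg x])
  have hχ1 : ∀ x, 2 ≤ ‖x‖ → χ x = 1 := fun x hx =>
    Real.smoothTransition.one_of_one_le (by nlinarith [norm_nonneg x])
  have hH2 : ∀ x, 2 ≤ ‖x‖ → H x = x := fun x hx => by simp [hH, hχ1 x hx]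
  have hHn : ∀ x, ‖x‖ ≤ 1 → ‖H x‖ = 1 := fun x hx => by
    simp [hH, hχ0 x hx, norm_smul, norm_ne_zero_iff.2 (hne x)]
  have hvol := integral_det_id_add_fderiv (g := fun x => H x - x) (hHs.sub contDiff_id) (R := 2)
    (fun x hx => by simp [hH2 x hx])
  have hD : ∀ x, ContinuousLinearMap.id ℝ E + fderiv ℝ (fun x => H x - x) x = fderiv ℝ H x := by
    intro x
    rw [fderiv_fun_sub (hHd x) differentiableAt_fun_id, fderiv_fun_id]
    abel
  simp only [hD] at hvol
  have hcd : Continuous fun x => (fderiv ℝ H x).det :=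
    ContinuousLinearMap.continuous_det.comp (hHs.continuous_fderiv one_ne_zero)
  have hintg : ∀ s ⊆ Metric.ball (0 : E) 2, IntegrableOn (fun x => (fderiv ℝ H x).det) s :=
    fun s hs => (hcd.continuousOn.integrableOn_compact (isCompact_closedBall (0 : E) 2)).mono_set
      (hs.trans Metric.ball_subset_closedBall)
  set A : Set E := Metric.ball 0 2 \ Metric.closedBall 0 1 with hA
  have hAm : MeasurableSet A := measurableSet_ball.diff measurableSet_closedBall
  have hsub : Metric.closedBall (0 : E) 1 ⊆ Metric.ball 0 2 :=
    Metric.closedBall_subset_ball (by norm_num)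
  have hdec : Metric.ball (0 : E) 2 = Metric.closedBall 0 1 ∪ A := (union_sdiff_cancel hsub).symm
  have hinner : ∫ x in Metric.closedBall (0 : E) 1, (fderiv ℝ H x).det = 0 := by
    rw [← integral_indicator measurableSet_closedBall, integral_eq_zero_of_ae]
    have hsph : ∀ᵐ x : E, x ∉ Metric.sphere (0 : E) 1 :=
      measure_eq_zero_iff_ae_notMem.1 (Measure.addHaar_sphere volume 0 1)
    filter_upwards [hsph] with x hx
    by_cases hxb : x ∈ Metric.closedBall (0 : E) 1
    · have hx1 : x ∈ Metric.ball (0 : E) 1 := by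
        rw [mem_ball_zero_iff]
        exact lt_of_le_of_ne (mem_closedBall_zero_iff.1 hxb) fun h => hx (mem_sphere_zero_iff_norm.2 h)
      rw [indicator_of_mem hxb]
      refine det_eq_zero_of_norm_eventually_const one_ne_zero (hHd x).hasFDerivAt ?_
      filter_upwards [Metric.isOpen_ball.mem_nhds hx1] with y hy
      exact hHn y (mem_ball_zero_iff.1 hy).le
    · rw [indicator_of_notMem hxb, Pi.zero_apply]
  have hsplit := setIntegral_union disjoint_sdiff_right hAm (hintg _ hsub) (hintg A sdiff_subset)
  rw [← hdec, hinner, zero_add] at hsplit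
  rw [hsplit] at hvol
  have hAe : ∀ x ∈ A, 1 < ‖x‖ ∧ ‖x‖ < 2 := fun x hx => by
    simpa [hA, and_comm] using hx
  have hχle : ∀ x, χ x ≤ 1 := fun x => Real.smoothTransition.le_one _
  have hHA : ∀ x, 1 < ‖x‖ → H x = (χ x + (1 - χ x) * ‖x‖⁻¹) • x := fun x hx => by
    simp only [hH, hid x hx.le, smul_smul, add_smul]
  have hpos : ∀ x, 1 < ‖x‖ → 0 < χ x + (1 - χ x) * ‖x‖⁻¹ := fun x hx => by
    have h1 : 0 < χ x := Real.smoothTransition.pos_of_pos (by nlinarith)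
    have h2 := hχle x
    have : 0 ≤ (1 - χ x) * ‖x‖⁻¹ := mul_nonneg (by linarith) (by positivity)
    linarith
  have hnorm : ∀ x, 1 < ‖x‖ → ‖H x‖ = 1 + χ x * (‖x‖ - 1) := fun x hx => by
    rw [hHA x hx, norm_smul, Real.norm_of_nonneg (hpos x hx).le]
    field_simp
    ring
  have hmono : ∀ x y : E, 1 < ‖x‖ → ‖x‖ < ‖y‖ → ‖H x‖ < ‖H y‖ := fun x y hx hxy => by
    rw [hnorm x hx, hnorm y (hx.trans hxy)]
    have h0 : 0 < χ x := Real.smoothTransition.pos_of_pos (by nlinarith)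
    have h1 : χ x ≤ χ y := Real.smoothTransition.monotone (by
      have : ‖x‖ ^ 2 ≤ ‖y‖ ^ 2 := by gcongr
      linarith)
    nlinarith
  have hinj : InjOn H A := by
    intro x hx y hy hxy
    have hx' := (hAe x hx).1
    have hy' := (hAe y hy).1
    have hn : ‖x‖ = ‖y‖ := by
      rcases lt_trichotomy ‖x‖ ‖y‖ with h1 | h1 | h1
      · exact absurd (congrArg norm hxy) (hmono x y hx' h1).ne
      · exact h1
      · exact absurd (congrArg norm hxy) (hmono y x hy' h1).ne'
    have hχe : χ x = χ y := by simp only [hχ, hn]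
    rw [hHA x hx', hHA y hy', hχe, hn] at hxy
    exact smul_right_injective E (hpos y hy').ne' hxy
  have himg : H '' A ⊆ A := by
    rintro _ ⟨x, hx, rfl⟩
    obtain ⟨h1, h2⟩ := hAe x hx
    have h0 : 0 < χ x := Real.smoothTransition.pos_of_pos (by nlinarith)
    have h3 := hχle x
    have h4 := hnorm x h1
    simp only [hA, Set.mem_sdiff, mem_ball_zero_iff, mem_closedBall_zero_iff, not_le, h4]
    constructor <;> nlinarith
  have hcv := integral_image_eq_integral_abs_det_fderiv_smul (volume : Measure E) hAm
    (fun x _ => (hHd x).hasFDerivAt.hasFDerivWithinAt) hinj (fun _ => (1 : ℝ))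
  simp only [integral_const, smul_eq_mul, mul_one, measureReal_restrict_apply_univ] at hcv
  have hAfin : volume A ≠ ∞ := measure_ne_top_of_subset sdiff_subset measure_ball_lt_top.ne
  have h1 : ∫ x in A, (fderiv ℝ H x).det ≤ ∫ x in A, |(fderiv ℝ H x).det| :=
    integral_mono (hintg _ sdiff_subset) (hintg _ sdiff_subset).abs fun x => le_abs_self _
  have h2 : volume.real (H '' A) ≤ volume.real A := measureReal_mono himg hAfin
  have h3 : volume.real A = volume.real (Metric.ball (0 : E) 2) -
      volume.real (Metric.closedBall (0 : E) 1) :=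
    measureReal_sdiff hsub measurableSet_closedBall
  have h4 : 0 < volume.real (Metric.closedBall (0 : E) 1) :=
    ENNReal.toReal_pos (Metric.measure_closedBall_pos volume _ one_pos).ne'
      measure_closedBall_lt_top.ne
  linarith

/-- Smoothing h - id within the positive lower bound c of |h|, without enlarging its support,
reduces this to the C¹ case: a zero of the smoothed map would be a point where |h| < c. -/
theorem exists_zero_of_continuous_of_eq_id [Nontrivial E] {h : E → E} (hh : Continuous h)
    (hid : ∀ x, 1 ≤ ‖x‖ → h x = x) : ∃ x, h x = 0 := by
  by_contra! hne
  obtain ⟨c, hc, hcb⟩ : ∃ c > 0, ∀ x, c ≤ ‖h x‖ := by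
    obtain ⟨x₀, -, hx₀⟩ := (isCompact_closedBall (0 : E) 1).exists_isMinOn
      ⟨0, by simp⟩ hh.norm.continuousOn
    refine ⟨min 1 ‖h x₀‖, lt_min one_pos (norm_pos_iff.2 (hne _)), fun x => ?_⟩
    rcases le_total ‖x‖ 1 with hx | hx
    · exact (min_le_right _ _).trans (hx₀ (mem_closedBall_zero_iff.2 hx))
    · exact (min_le_left _ _).trans (by rwa [hid x hx])
  obtain ⟨g, hg, happ, hsupp⟩ := (hh.sub continuous_id).exists_contDiff_approx 1
    (ε := fun _ => c) continuous_const fun _ => hc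
  obtain ⟨x, hx⟩ := exists_zero_of_contDiff_of_eq_id (h := fun x => x + g x)
    (contDiff_id.add hg) fun x hx => by
      have : g x = 0 := by
        by_contra hgx
        exact hsupp hgx (by simp [hid x hx])
      simp [this]
  have h1 := happ x
  have h2 : g x = -x := eq_neg_of_add_eq_zero_right hx
  simp only [dist_eq_norm, h2, Pi.sub_apply, id] at h1
  have h3 : -x - (h x - x) = -h x := by abel
  rw [h3, norm_neg] at h1
  exact (hcb x).not_gt h1

/-- A form of Brouwer's fixed point theorem. -/
theorem exists_zero_of_norm_sub_self_le [Nontrivial E] {r : ℝ} (hr : 0 < r) {F : E → E}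
    (hF : ContinuousOn F (Metric.closedBall 0 r)) (hle : ∀ x ∈ Metric.closedBall 0 r, ‖F x - x‖ ≤ r) :
    ∃ x ∈ Metric.closedBall 0 r, F x = 0 := by
  set P : E → E := fun x => (r / max r ‖x‖) • x with hP
  have hm : ∀ x : E, 0 < max r ‖x‖ := fun x => lt_max_of_lt_left hr
  have hPc : Continuous P := by
    refine Continuous.smul (continuous_const.div (continuous_const.max continuous_norm)
      fun x => (hm x).ne') continuous_id
  have hPm : ∀ x, P x ∈ Metric.closedBall (0 : E) r := fun x => by
    rw [mem_closedBall_zero_iff, hP, norm_smul, Real.norm_of_nonneg (by positivity),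
      div_mul_eq_mul_div, div_le_iff₀ (hm x)]
    gcongr
    exact le_max_right _ _
  set χ : E → ℝ := fun x => max 0 (min 1 (2 - ‖x‖ / r)) with hχ
  have hχc : Continuous χ := by fun_prop
  -- P retracts onto the ball, and the cutoff χ is 1 on it and 0 beyond radius 2r. Rescaling by 2r
  -- makes the perturbation vanish for |y| ≥ 1.
  obtain ⟨y, hy⟩ := exists_zero_of_continuous_of_eq_id
    (h := fun y => y + (χ ((2 * r) • y) / (2 * r)) •
      (F (P ((2 * r) • y)) - P ((2 * r) • y))) (by
      have h1 : Continuous fun y : E => P ((2 * r) • y) := by fun_prop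
      have h2 : Continuous fun y : E => F (P ((2 * r) • y)) := hF.comp_continuous h1 fun _ => hPm _
      have h3 : Continuous fun y : E => χ ((2 * r) • y) / (2 * r) :=
        (hχc.comp (continuous_const_smul _)).div_const _
      exact continuous_id.add (h3.smul (h2.sub h1))) (fun y hy => by
      have : χ ((2 * r) • y) = 0 := by
        simp only [hχ, norm_smul, Real.norm_of_nonneg (by positivity : 0 ≤ 2 * r)]
        apply max_eq_left
        apply (min_le_right _ _).trans
        have : 2 * r * ‖y‖ / r = 2 * ‖y‖ := by field_simp
        rw [this]; linarith
      simp [this])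
  set x := (2 * r) • y with hx
  have hxe : x + χ x • (F (P x) - P x) = 0 := by
    have := congrArg (fun z => (2 * r) • z) hy
    simpa [smul_add, smul_smul, ← hx, mul_div_cancel₀, hr.ne'] using this
  have hχ1 : ∀ x, χ x ≤ 1 := fun x => max_le zero_le_one (min_le_left _ _)
  have hχ0 : ∀ x, 0 ≤ χ x := fun x => le_max_left _ _
  -- At the zero, x = -χ(x)(F(Px) - Px) has norm at most r, so the retraction and the cutoff have no
  -- effect there.
  have hxr : ‖x‖ ≤ r := by
    rw [eq_neg_of_add_eq_zero_left hxe, norm_neg, norm_smul, Real.norm_of_nonneg (hχ0 x)]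
    calc χ x * ‖F (P x) - P x‖ ≤ 1 * r := by
          gcongr
          · exact hχ1 x
          · exact hle _ (hPm x)
      _ = r := one_mul r
  have hPx : P x = x := by simp [hP, max_eq_left hxr, hr.ne']
  have hχx : χ x = 1 := by
    have : ‖x‖ / r ≤ 1 := (div_le_one hr).2 hxr
    simp only [hχ]
    rw [min_eq_left (by linarith), max_eq_right zero_le_one]
  refine ⟨x, mem_closedBall_zero_iff.2 hxr, ?_⟩
  rw [hPx, hχx, one_smul] at hxe
  simpa using hxe

end Zeros

/-! ### Invariance of domain. -/

section InvarianceOfDomain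

variable {E : Type*} [NormedAddCommGroup E] [InnerProductSpace ℝ E] [FiniteDimensional ℝ E]

/-- A C¹ approximation maps the sphere to a null set, so an arbitrarily small translation moves that
image off 0. -/
theorem exists_continuous_approx_ne_zero_on_sphere {G : E → E} (hG : Continuous G) {δ : ℝ}
    (hδ : 0 < δ) (c : E) {ε : ℝ} (hε : 0 < ε) :
    ∃ P : E → E, Continuous P ∧ (∀ x, ‖P x - G x‖ < δ) ∧ ∀ x ∈ Metric.sphere c ε, P x ≠ 0 := by
  borelize E
  obtain ⟨P, hP, happ, -⟩ := hG.exists_contDiff_approx 1 (ε := fun _ => δ / 2) continuous_const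
    fun _ => half_pos hδ
  have hnull : volume (P '' Metric.sphere c ε) = 0 :=
    addHaar_image_eq_zero_of_differentiableOn_of_addHaar_eq_zero volume
      (hP.differentiable one_ne_zero).differentiableOn
      (Measure.addHaar_sphere_of_ne_zero volume c hε.ne')
  obtain ⟨v, hv, hvn⟩ : ∃ v ∈ Metric.ball (0 : E) (δ / 2), v ∉ P '' Metric.sphere c ε := by
    by_contra! h
    have := measure_mono_null h hnull
    exact (Metric.measure_ball_pos volume (0 : E) (half_pos hδ)).ne' this
  refine ⟨fun x => P x - v, hP.continuous.sub continuous_const, fun x => ?_, fun x hx h0 => ?_⟩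
  · have h1 := happ x
    rw [dist_eq_norm] at h1
    rw [mem_ball_zero_iff] at hv
    calc ‖P x - v - G x‖ = ‖(P x - G x) - v‖ := by congr 1; abel
      _ ≤ ‖P x - G x‖ + ‖v‖ := norm_sub_le _ _
      _ < δ := by linarith
  · exact hvn ⟨x, hx, sub_eq_zero.1 h0⟩

/-- Let G extend the inverse of f from f(B) to the whole space. If f 0 were not interior, there
would be a point c near f 0 outside f(B), and Φ could push the part of f(B) near c out to a sphere
about c. An approximation P of G without zeros on that sphere, and closer to G than the minimum of
|G| on the rest of f(B), makes P ∘ Φ ∘ f free of zeros. Yet this map stays within r of the identity,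
contrary to Brouwer. -/
theorem mem_interior_image_closedBall [Nontrivial E] {f : E → E} {r : ℝ} (hr : 0 < r)
    (hf : ContinuousOn f (Metric.closedBall 0 r)) (hinj : InjOn f (Metric.closedBall 0 r)) :
    f 0 ∈ interior (f '' Metric.closedBall 0 r) := by
  set B := Metric.closedBall (0 : E) r with hB
  have hBc : IsCompact B := isCompact_closedBall 0 r
  have h0B : (0 : E) ∈ B := Metric.mem_closedBall_self hr.le
  have : CompactSpace B := isCompact_iff_compactSpace.1 hBc
  have hemb : IsClosedEmbedding (B.domRestrict f) :=
    hf.domRestrict.isClosedEmbedding hinj.injective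
  obtain ⟨G, hGext⟩ := ContinuousMap.exists_extension' hemb
    (⟨Subtype.val, continuous_subtype_val⟩ : C(B, E))
  have hG : ∀ x ∈ B, G (f x) = x := fun x hx => congrFun hGext ⟨x, hx⟩
  obtain ⟨ε, hε, hGε⟩ : ∃ ε > 0, ∀ y, ‖y - f 0‖ < 2 * ε → ‖G y‖ < r / 10 := by
    have h1 : ∀ᶠ y in 𝓝 (f 0), ‖G y‖ < r / 10 := by
      refine (G.continuous.norm.tendsto (f 0)).eventually_lt_const ?_
      rw [hG 0 h0B, norm_zero]
      positivity
    obtain ⟨ε, hε, h⟩ := Metric.eventually_nhds_iff.1 h1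
    exact ⟨ε / 2, half_pos hε, fun y hy => h (by rw [dist_eq_norm]; linarith)⟩
  by_contra hint
  obtain ⟨c, hcε, hcK⟩ : ∃ c, ‖c - f 0‖ < ε ∧ c ∉ f '' B := by
    by_contra! h
    exact hint (mem_interior_iff_mem_nhds.2 (mem_of_superset (Metric.ball_mem_nhds _ hε)
      fun y hy => h y (by simpa [dist_eq_norm] using hy)))
  have hKc : IsCompact (f '' B) := hBc.image_of_continuousOn hf
  -- On f(B), G vanishes only at f 0, which lies within ε of c.
  obtain ⟨m, hm, hmG⟩ : ∃ m > 0, ∀ y ∈ f '' B, ε ≤ ‖y - c‖ → m ≤ ‖G y‖ := by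
    have hS : IsCompact (f '' B ∩ {y | ε ≤ ‖y - c‖}) :=
      hKc.inter_right (isClosed_le continuous_const (by fun_prop))
    rcases (f '' B ∩ {y | ε ≤ ‖y - c‖}).eq_empty_or_nonempty with he | hne
    · refine ⟨1, one_pos, fun y hy hyc => ?_⟩
      have : y ∈ f '' B ∩ {y | ε ≤ ‖y - c‖} := ⟨hy, hyc⟩
      simp [he] at this
    · obtain ⟨y₀, ⟨⟨x₀, hx₀, rfl⟩, hy₀⟩, hmin⟩ := hS.exists_isMinOn hne G.continuous.norm.continuousOn
      refine ⟨‖G (f x₀)‖, ?_, fun y hy hyc => hmin ⟨hy, hyc⟩⟩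
      rw [hG x₀ hx₀, gt_iff_lt, norm_pos_iff]
      rintro rfl
      rw [mem_ofPred_eq, norm_sub_rev] at hy₀
      linarith
  set δ := min m (r / 10)
  have hδ : 0 < δ := lt_min hm (by positivity)
  obtain ⟨P, hPc, hPG, hP0⟩ := exists_continuous_approx_ne_zero_on_sphere G.continuous hδ c hε
  set Φ : E → E := fun y => c + max (ε / ‖y - c‖) 1 • (y - c) with hΦ
  have hne : ∀ y ∈ f '' B, 0 < ‖y - c‖ := fun y hy => by
    rw [norm_pos_iff, sub_ne_zero]
    rintro rfl
    exact hcK hy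
  have hΦ1 : ∀ y ∈ f '' B, ε ≤ ‖y - c‖ → Φ y = y := fun y hy hyc => by
    have : ε / ‖y - c‖ ≤ 1 := (div_le_one (hne y hy)).2 hyc
    simp [hΦ, max_eq_right this]
  have hΦ2 : ∀ y ∈ f '' B, ‖y - c‖ < ε → ‖Φ y - c‖ = ε := fun y hy hyc => by
    have h1 := hne y hy
    have : 1 ≤ ε / ‖y - c‖ := (one_le_div h1).2 hyc.le
    simp only [hΦ, add_sub_cancel_left, max_eq_left this, norm_smul]
    rw [Real.norm_of_nonneg (by positivity), div_mul_cancel₀ _ h1.ne']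
  have hΦc : ContinuousOn Φ (f '' B) := by
    refine continuousOn_const.add (ContinuousOn.smul (ContinuousOn.sup (ContinuousOn.div
      continuousOn_const (by fun_prop) fun y hy => (hne y hy).ne') continuousOn_const) (by fun_prop))
  have hFc : ContinuousOn (fun x => P (Φ (f x))) B :=
    hPc.comp_continuousOn (hΦc.comp hf (mapsTo_image f B))
  have hδ1 : δ ≤ m := min_le_left _ _
  have hδ2 : δ ≤ r / 10 := min_le_right _ _
  obtain ⟨x, hx, hx0⟩ := exists_zero_of_norm_sub_self_le hr hFc fun x hx => by
    have hy := mem_image_of_mem f hx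
    rcases le_or_gt ε ‖f x - c‖ with h1 | h1
    · rw [hΦ1 _ hy h1]
      have := hPG (f x)
      rw [hG x hx] at this
      linarith
    · have h2 := hPG (Φ (f x))
      have h3 : ‖G (Φ (f x))‖ < r / 10 := hGε _ (by
        calc ‖Φ (f x) - f 0‖ = ‖(Φ (f x) - c) + (c - f 0)‖ := by congr 1; abel
          _ ≤ ‖Φ (f x) - c‖ + ‖c - f 0‖ := norm_add_le _ _
          _ < 2 * ε := by rw [hΦ2 _ hy h1]; linarith)
      have h4 : ‖G (f x)‖ < r / 10 := hGε _ (by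
        calc ‖f x - f 0‖ = ‖(f x - c) + (c - f 0)‖ := by congr 1; abel
          _ ≤ ‖f x - c‖ + ‖c - f 0‖ := norm_add_le _ _
          _ < 2 * ε := by linarith)
      rw [hG x hx] at h4
      calc ‖P (Φ (f x)) - x‖ = ‖(P (Φ (f x)) - G (Φ (f x))) + (G (Φ (f x)) - x)‖ := by
            congr 1; abel
        _ ≤ ‖P (Φ (f x)) - G (Φ (f x))‖ + (‖G (Φ (f x))‖ + ‖x‖) :=
            (norm_add_le _ _).trans (by gcongr; exact norm_sub_le _ _)
        _ ≤ r := by linarith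
  have hy := mem_image_of_mem f hx
  rcases le_or_gt ε ‖f x - c‖ with h1 | h1
  · rw [hΦ1 _ hy h1] at hx0
    have h2 := hPG (f x)
    rw [hx0, zero_sub, norm_neg] at h2
    linarith [hmG _ hy h1]
  · exact hP0 _ (by rw [mem_sphere_iff_norm, hΦ2 _ hy h1]) hx0

/-- **Invariance of domain**. -/
theorem isOpen_image_of_continuousOn_of_injOn [Nontrivial E] {f : E → E} {U : Set E}
    (hU : IsOpen U) (hf : ContinuousOn f U) (hinj : InjOn f U) : IsOpen (f '' U) := by
  rw [isOpen_iff_mem_nhds]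
  rintro _ ⟨x, hx, rfl⟩
  obtain ⟨r, hr, hrU⟩ := Metric.nhds_basis_closedBall.mem_iff.1 (hU.mem_nhds hx)
  have hmaps : MapsTo (fun y => x + y) (Metric.closedBall 0 r) U := fun y hy => hrU (by
    simpa [dist_eq_norm] using hy)
  have h := mem_interior_image_closedBall (f := fun y => f (x + y)) hr
    (hf.comp (by fun_prop) hmaps) (fun y hy z hz hyz => by
      simpa using hinj (hmaps hy) (hmaps hz) hyz)
  rw [add_zero] at h
  refine mem_of_superset (mem_interior_iff_mem_nhds.1 h) ?_
  rintro _ ⟨y, hy, rfl⟩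
  exact mem_image_of_mem f (hmaps hy)

end InvarianceOfDomain

/-! ### Rays and images of spheres. -/

section Rays

variable {E : Type*} [NormedAddCommGroup E] [InnerProductSpace ℝ E] [FiniteDimensional ℝ E]

/-- The ray from `f 0` in the direction `u` reaches the image of each sphere about `0`, and stays in
the image of the ball until then. -/
theorem exists_first_exit [Nontrivial E] {f : E → E} {r : ℝ} (hr : 0 < r)
    (hf : ContinuousOn f (Metric.closedBall 0 r)) (hinj : InjOn f (Metric.closedBall 0 r))
    (hf0 : f 0 = 0) {u : E} (hu : ‖u‖ = 1) :
    ∃ s : ℝ, 0 < s ∧ s • u ∈ f '' Metric.sphere 0 r ∧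
      ∀ t, 0 ≤ t → t < s → t • u ∈ f '' Metric.ball 0 r := by
  set V := f '' Metric.ball 0 r with hV
  have hVo : IsOpen V := isOpen_image_of_continuousOn_of_injOn Metric.isOpen_ball
    (hf.mono Metric.ball_subset_closedBall) (hinj.mono Metric.ball_subset_closedBall)
  have hKc : IsCompact (f '' Metric.closedBall 0 r) :=
    (isCompact_closedBall 0 r).image_of_continuousOn hf
  have hVK : V ⊆ f '' Metric.closedBall 0 r := image_mono Metric.ball_subset_closedBall
  have h0V : (0 : E) ∈ V := ⟨0, Metric.mem_ball_self hr, hf0⟩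
  -- As V is open, the infimum s of T is attained: s • u is outside V but in its closure, hence in
  -- the image of the sphere.
  set T : Set ℝ := {t | 0 ≤ t ∧ t • u ∉ V} with hT
  have hcont : Continuous fun t : ℝ => t • u := by fun_prop
  have hTc : IsClosed T := isClosed_Ici.inter (hVo.isClosed_compl.preimage hcont)
  have hTb : BddBelow T := ⟨0, fun t ht => ht.1⟩
  have hTne : T.Nonempty := by
    obtain ⟨M, hM⟩ := hKc.isBounded.exists_norm_le
    refine ⟨|M| + 1, by positivity, fun h => ?_⟩
    have := hM _ (hVK h)
    rw [norm_smul, hu, mul_one, Real.norm_of_nonneg (by positivity)] at this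
    linarith [le_abs_self M]
  set s := sInf T with hs
  have hsT : s ∈ T := hTc.csInf_mem hTne hTb
  have hlt : ∀ t, 0 ≤ t → t < s → t • u ∈ V := fun t h0 hts => by
    by_contra h
    exact (csInf_le hTb ⟨h0, h⟩).not_gt hts
  have hs0 : 0 < s := by
    refine lt_of_le_of_ne hsT.1 fun h => hsT.2 ?_
    rw [← h, zero_smul]
    exact h0V
  refine ⟨s, hs0, ?_, hlt⟩
  have hcl : s • u ∈ f '' Metric.closedBall 0 r := by
    have h1 : s ∈ closure (Ico 0 s) := by
      rw [closure_Ico hs0.ne]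
      exact right_mem_Icc.2 hs0.le
    exact closure_minimal hVK hKc.isClosed 
      (map_mem_closure (f := fun t : ℝ => t • u) hcont h1 fun t ht => hlt t ht.1 ht.2)
  obtain ⟨x, hx, hxs⟩ := hcl
  refine ⟨x, ?_, hxs⟩
  by_contra hxn
  refine hsT.2 ⟨x, ?_, hxs⟩
  rw [mem_closedBall_zero_iff] at hx
  rw [mem_sphere_zero_iff_norm] at hxn
  exact mem_ball_zero_iff.2 (lt_of_le_of_ne hx hxn)

/-- The first exit from the smaller image precedes that from the larger one: by injectivity, the
second exit point lies outside the image of the smaller closed ball. -/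
theorem exists_radial_segment [Nontrivial E] {f : E → E} {r₁ r₂ : ℝ} (hr₁ : 0 < r₁) (hr : r₁ < r₂)
    (hf : ContinuousOn f (Metric.closedBall 0 r₂)) (hinj : InjOn f (Metric.closedBall 0 r₂))
    (hf0 : f 0 = 0) {u : E} (hu : ‖u‖ = 1) :
    ∃ s₁ s₂ : ℝ, 0 < s₁ ∧ s₁ < s₂ ∧ s₁ • u ∈ f '' Metric.sphere 0 r₁ ∧
      s₂ • u ∈ f '' Metric.sphere 0 r₂ ∧ ∀ t ∈ Ioo s₁ s₂, t • u ∈ f '' Metric.ball 0 r₂ := by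
  have hsub : Metric.closedBall (0 : E) r₁ ⊆ Metric.closedBall 0 r₂ :=
    Metric.closedBall_subset_closedBall hr.le
  obtain ⟨s₁, h1, h1s, h1b⟩ := exists_first_exit hr₁ (hf.mono hsub) (hinj.mono hsub) hf0 hu
  obtain ⟨s₂, h2, h2s, h2b⟩ := exists_first_exit (hr₁.trans hr) hf hinj hf0 hu
  have hdisj : s₂ • u ∉ f '' Metric.closedBall 0 r₁ := by
    rintro ⟨x, hx, hxs⟩
    obtain ⟨y, hy, hys⟩ := h2s
    have := hinj (hsub hx) (Metric.sphere_subset_closedBall hy) (hxs.trans hys.symm)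
    rw [this, mem_closedBall_zero_iff, mem_sphere_zero_iff_norm.1 hy] at hx
    linarith
  refine ⟨s₁, s₂, h1, ?_, h1s, h2s, fun t ht => h2b t (h1.le.trans ht.1.le) ht.2⟩
  by_contra hle
  rw [not_lt] at hle
  rcases hle.lt_or_eq with h | h
  · exact hdisj (image_mono Metric.ball_subset_closedBall (h1b s₂ h2.le h))
  · exact hdisj (h ▸ image_mono Metric.sphere_subset_closedBall h1s)

end Rays

/-! ### Line integrals along radial segments. -/

section RadialCurves

variable {n : ℕ}

theorem hasUnitSpeedOn_smul {u : Rn n} (hu : ‖u‖ = 1) (s : Set ℝ) :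
    HasUnitSpeedOn (fun t : ℝ => t • u) s := by
  intro x hx y hy
  have h1 : eVariationOn (fun t : ℝ => t • u) (s ∩ Icc x y) = eVariationOn (id : ℝ → ℝ) (s ∩ Icc x y) := by
    simp only [eVariationOn]
    congr! 4 with p i
    rw [edist_dist, edist_dist, dist_eq_norm, ← sub_smul, norm_smul, hu, mul_one, dist_eq_norm]
    rfl
  rcases le_or_gt x y with hxy | hxy
  · rw [h1, (monotoneOn_id).eVariationOn_eq hx hy]
    simp
  · rw [Icc_eq_empty hxy.not_ge, inter_empty, eVariationOn.subsingleton _ subsingleton_empty,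
      ENNReal.ofReal_of_nonpos]
    rw [NNReal.coe_one, one_mul]
    linarith

/-- The radial segment `t ↦ t u`, `a ≤ t ≤ b`. -/
noncomputable def radialCurve (u : Rn n) {a b : ℝ} (hab : a < b) : Curve n where
  a := a
  b := b
  hab := hab
  toFun t := t • u
  continuousOn := by fun_prop

theorem length_radialCurve {u : Rn n} (hu : ‖u‖ = 1) {a b : ℝ} (hab : a < b) :
    (radialCurve u hab).length = ENNReal.ofReal (b - a) := by
  have h := hasUnitSpeedOn_smul hu (Icc a b) (left_mem_Icc.2 hab.le) (right_mem_Icc.2 hab.le)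
  rw [inter_self, NNReal.coe_one, one_mul] at h
  exact h

theorem lineIntegral_radialCurve {u : Rn n} (hu : ‖u‖ = 1) {a b : ℝ} (hab : a < b)
    (ρ : Rn n → ℝ≥0∞) :
    (radialCurve u hab).lineIntegral ρ = ∫⁻ t in Icc a b, ρ (t • u) := by
  have hspeed := hasUnitSpeedOn_smul hu (Icc a b)
  obtain ⟨hlb, hvar⟩ := hasConstantSpeedOnWith_iff_variationOnFromTo_eq.1 hspeed
  have ha : a ∈ Icc a b := left_mem_Icc.2 hab.le
  rw [Curve.lineIntegral, length_radialCurve hu hab, ENNReal.toReal_ofReal (by linarith)]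
  have h1 : ∫⁻ s in Icc 0 (b - a), ρ (naturalParameterization (radialCurve u hab).toFun
      (Icc a b) a s) = ∫⁻ s in Icc 0 (b - a), ρ ((s + a) • u) := by
    refine setLIntegral_congr_fun measurableSet_Icc fun s hs => ?_
    have hsa : s + a ∈ Icc a b := ⟨by linarith [hs.1], by linarith [hs.2]⟩
    have h2 := edist_naturalParameterization_eq_zero hlb ha hsa
    rw [hvar ha hsa, NNReal.coe_one, one_mul, add_sub_cancel_right, edist_eq_zero] at h2
    exact congrArg ρ h2
  refine h1.trans ?_
  have h3 := (measurePreserving_add_right (volume : Measure ℝ) a).setLIntegral_comp_preimage_emb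
    (measurableEmbedding_addRight a) (fun t => ρ (t • u)) (Icc a b)
  rw [← h3]
  simp

end RadialCurves

/-! ### Polar coordinates. -/

section Polar

/-- Integration in polar coordinates. -/
theorem lintegral_eq_lintegral_Ioi_lintegral_sphere {E : Type*} [NormedAddCommGroup E]
    [NormedSpace ℝ E] [FiniteDimensional ℝ E] [Nontrivial E] [MeasurableSpace E] [BorelSpace E]
    (μ : Measure E) [μ.IsAddHaarMeasure] {F : E → ℝ≥0∞} (hF : Measurable F) :
    ∫⁻ x, F x ∂μ = ∫⁻ t in Ioi (0 : ℝ), ENNReal.ofReal (t ^ (Module.finrank ℝ E - 1)) *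
      ∫⁻ u : Metric.sphere (0 : E) 1, F (t • (u : E)) ∂μ.toSphere := by
  have hg : Measurable fun y : Metric.sphere (0 : E) 1 × Ioi (0 : ℝ) => F ((y.2 : ℝ) • (y.1 : E)) :=
    hF.comp (by fun_prop)
  have h1 : ∫⁻ x, F x ∂μ = ∫⁻ x : ({(0)}ᶜ : Set E), F x ∂(μ.comap (↑)) := by
    rw [lintegral_subtype_comap (measurableSet_singleton _).compl, restrict_compl_singleton]
  have h2 := μ.measurePreserving_homeomorphUnitSphereProd.lintegral_comp hg
  have h3 : ∀ x : ({(0)}ᶜ : Set E), (((homeomorphUnitSphereProd E x).2 : ℝ) •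
      ((homeomorphUnitSphereProd E x).1 : E)) = x := by
    intro x
    rw [← homeomorphUnitSphereProd_symm_apply_coe, Homeomorph.symm_apply_apply]
  simp only [h3] at h2
  rw [h1, h2, lintegral_prod_symm' _ hg, Measure.volumeIoiPow,
    lintegral_withDensity_eq_lintegral_mul _ (by fun_prop) hg.lintegral_prod_left',
    ← lintegral_subtype_comap measurableSet_Ioi]
  rfl

end Polar

/-! ### One-dimensional estimates. -/

section RadialEstimates

theorem lintegral_Ioc_rpow {r : ℝ} (hr : -1 < r) {a b : ℝ} (ha : 0 ≤ a) (hab : a ≤ b) :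
    ∫⁻ t in Ioc a b, ENNReal.ofReal (t ^ r) =
      ENNReal.ofReal ((b ^ (r + 1) - a ^ (r + 1)) / (r + 1)) := by
  rw [← integral_rpow (Or.inl hr), intervalIntegral.integral_of_le hab,
    ofReal_integral_eq_lintegral_ofReal]
  · exact (intervalIntegral.intervalIntegrable_rpow' hr).1
  · filter_upwards [ae_restrict_mem measurableSet_Ioc] with t ht
    exact Real.rpow_nonneg (ha.trans ht.1.le) _

/-- Hölder's inequality with the weight `t ^ (n - 1)`. -/
theorem le_lintegral_Ioi_pow_mul_rpow {n : ℕ} (hn : 1 ≤ n) {p : ℝ} (hp : (n : ℝ) < p)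
    {φ : ℝ → ℝ≥0∞} (hφ : Measurable φ) {b : ℝ} (hb : 0 < b) (h : 1 ≤ ∫⁻ t in Ioc 0 b, φ t) :
    ENNReal.ofReal (((p - n) / (p - 1)) ^ (p - 1) * b ^ ((n : ℝ) - p)) ≤
      ∫⁻ t in Ioi (0 : ℝ), ENNReal.ofReal (t ^ (n - 1)) * φ t ^ p := by
  have hn' : (1 : ℝ) ≤ n := by exact_mod_cast hn
  have hp1 : 1 < p := hn'.trans_lt hp
  have hp0 : 0 < p := by linarith
  have hp1' : 0 < p - 1 := by linarith
  set q := p / (p - 1) with hq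
  have hpq : p.HolderConjugate q := Real.HolderConjugate.conjExponent hp1
  set α := (p - n) / (p - 1) with hα
  have hα0 : 0 < α := div_pos (by linarith) hp1'
  -- Splitting φ = (t^κ φ) t^{-κ} puts the weight t^{n-1} into the p-th power of the first factor.
  -- The q-th power of the second is t^{α-1}, integrable at 0 because p > n.
  set κ := ((n : ℝ) - 1) / p with hκ
  set A := ∫⁻ t in Ioi (0 : ℝ), ENNReal.ofReal (t ^ (n - 1)) * φ t ^ p with hA
  have hH := ENNReal.lintegral_mul_le_Lp_mul_Lq (volume.restrict (Ioc 0 b)) hpq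
    (f := fun t => ENNReal.ofReal (t ^ κ) * φ t) (g := fun t => ENNReal.ofReal (t ^ (-κ)))
    (by fun_prop) (by fun_prop)
  have h1 : ∫⁻ t in Ioc 0 b, ((fun t => ENNReal.ofReal (t ^ κ) * φ t) *
      fun t => ENNReal.ofReal (t ^ (-κ))) t = ∫⁻ t in Ioc 0 b, φ t := by
    refine setLIntegral_congr_fun measurableSet_Ioc fun t ht => ?_
    simp only [Pi.mul_apply]
    rw [mul_right_comm, ← ENNReal.ofReal_mul (Real.rpow_nonneg ht.1.le _), ← Real.rpow_add ht.1,
      add_neg_cancel, Real.rpow_zero, ENNReal.ofReal_one, one_mul]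
  have h2 : ∫⁻ t in Ioc 0 b, (ENNReal.ofReal (t ^ κ) * φ t) ^ p ≤ A := by
    refine le_trans (le_of_eq ?_) 
      (lintegral_mono_set (Ioc_subset_Ioi_self : Ioc 0 b ⊆ Ioi 0))
    refine setLIntegral_congr_fun measurableSet_Ioc fun t ht => ?_
    rw [ENNReal.mul_rpow_of_nonneg _ _ hp0.le,
      ENNReal.ofReal_rpow_of_nonneg (Real.rpow_nonneg ht.1.le _) hp0.le, ← Real.rpow_mul ht.1.le,
      div_mul_cancel₀ _ hp0.ne', ← Real.rpow_natCast, Nat.cast_sub hn, Nat.cast_one]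
  have h3 : ∫⁻ t in Ioc 0 b, ENNReal.ofReal (t ^ (-κ)) ^ q = ENNReal.ofReal (b ^ α / α) := by
    have he : -κ * q = α - 1 := by
      rw [hκ, hq, hα]
      field_simp
      ring
    have h4 : ∫⁻ t in Ioc 0 b, ENNReal.ofReal (t ^ (-κ)) ^ q =
        ∫⁻ t in Ioc 0 b, ENNReal.ofReal (t ^ (α - 1)) := by
      refine setLIntegral_congr_fun measurableSet_Ioc fun t ht => ?_
      rw [ENNReal.ofReal_rpow_of_nonneg (Real.rpow_nonneg ht.1.le _) hpq.symm.nonneg,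
        ← Real.rpow_mul ht.1.le, he]
    rw [h4, lintegral_Ioc_rpow (by linarith) le_rfl hb.le]
    simp [hα0.ne']
  rw [h1, h3] at hH
  have h5 : 1 ≤ A ^ (1 / p) * ENNReal.ofReal (b ^ α / α) ^ (1 / q) :=
    h.trans (hH.trans (by gcongr))
  have hB : 0 < b ^ α / α := div_pos (Real.rpow_pos_of_pos hb _) hα0
  have h6 : 1 ≤ A * ENNReal.ofReal ((b ^ α / α) ^ (p - 1)) := by
    have h7 := ENNReal.rpow_le_rpow h5 hp0.le
    rw [ENNReal.one_rpow, ENNReal.mul_rpow_of_nonneg _ _ hp0.le, ← ENNReal.rpow_mul,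
      ← ENNReal.rpow_mul, one_div_mul_cancel hp0.ne', ENNReal.rpow_one] at h7
    have he : 1 / q * p = p - 1 := by rw [hq]; field_simp
    rwa [he, ENNReal.ofReal_rpow_of_pos hB] at h7
  have hBp : 0 < (b ^ α / α) ^ (p - 1) := Real.rpow_pos_of_pos hB _
  have he : α ^ (p - 1) * b ^ ((n : ℝ) - p) = ((b ^ α / α) ^ (p - 1))⁻¹ := by
    rw [Real.div_rpow (Real.rpow_nonneg hb.le _) hα0.le, ← Real.rpow_mul hb.le, inv_div,
      div_eq_mul_inv, ← Real.rpow_neg hb.le, hα, div_mul_cancel₀ _ hp1'.ne', neg_sub]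
  rw [he, ENNReal.ofReal_inv_of_pos hBp]
  rw [mul_comm] at h6
  exact (ENNReal.inv_le_iff_le_mul (fun _ => (ENNReal.ofReal_pos.2 hBp).ne')
    fun h => absurd h ENNReal.ofReal_ne_top).2 h6

end RadialEstimates

/-! ### Lower bound for the modulus. -/

section LowerBound

/-- Lower bound for the modulus of a family of curves containing, in each direction, a radial segment
in the ball of radius `b`. -/
theorem le_pModulus_of_forall_radialCurve_mem {n : ℕ} (hn : 1 ≤ n) {p : ℝ} (hp : (n : ℝ) < p)
    {Γ : Set (Curve n)} {b : ℝ} (hb : 0 < b)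
    (h : ∀ u : Rn n, ‖u‖ = 1 → ∃ (s₁ s₂ : ℝ) (hs : s₁ < s₂), 0 < s₁ ∧ s₂ ≤ b ∧
      radialCurve u hs ∈ Γ) :
    ENNReal.ofReal (((p - n) / (p - 1)) ^ (p - 1) * b ^ ((n : ℝ) - p)) * unitSphereArea n ≤
      pModulus p Γ := by
  have : Nontrivial (Rn n) := by
    have : Nonempty (Fin n) := ⟨⟨0, hn⟩⟩
    infer_instance
  refine le_iInf₂ fun ρ hρ => ?_
  obtain ⟨hρm, hρΓ⟩ := hρ
  have hF : Measurable fun x => ρ x ^ p := hρm.pow_const p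
  rw [lintegral_eq_lintegral_Ioi_lintegral_sphere _ hF]
  have hjoint : Measurable fun y : ℝ × Metric.sphere (0 : Rn n) 1 =>
      ENNReal.ofReal (y.1 ^ (Module.finrank ℝ (Rn n) - 1)) * ρ (y.1 • (y.2 : Rn n)) ^ p := by
    refine Measurable.mul (by fun_prop) (hF.comp ?_)
    fun_prop
  have h1 : ∀ t : ℝ, ENNReal.ofReal (t ^ (Module.finrank ℝ (Rn n) - 1)) *
      ∫⁻ u : Metric.sphere (0 : Rn n) 1, ρ (t • (u : Rn n)) ^ p ∂volume.toSphere =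
      ∫⁻ u : Metric.sphere (0 : Rn n) 1, ENNReal.ofReal (t ^ (Module.finrank ℝ (Rn n) - 1)) *
        ρ (t • (u : Rn n)) ^ p ∂volume.toSphere := fun t =>
    (lintegral_const_mul' _ _ ENNReal.ofReal_ne_top).symm
  simp only [h1]
  -- With the direction as outer variable, the estimate can be made on each ray separately.
  rw [lintegral_lintegral_swap hjoint.aemeasurable, unitSphereArea, ← lintegral_const]
  refine lintegral_mono fun u => ?_
  have hu : ‖(u : Rn n)‖ = 1 := mem_sphere_zero_iff_norm.1 u.2
  obtain ⟨s₁, s₂, hs, hs₁, hs₂, hΓ⟩ := h u hu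
  have hlen := length_radialCurve hu hs
  have h2 := hρΓ _ hΓ (by rw [Curve.Rectifiable, hlen]; exact ENNReal.ofReal_ne_top)
  rw [lineIntegral_radialCurve hu] at h2
  have h3 := le_lintegral_Ioi_pow_mul_rpow hn hp (φ := fun t => ρ (t • (u : Rn n)))
    (hρm.comp (by fun_prop)) hb
    (h2.trans (lintegral_mono_set fun t ht => ⟨hs₁.trans_le ht.1, ht.2.trans hs₂⟩))
  simpa using h3

end LowerBound

/-! ### Integration over spheres and rings. -/

section UpperBound

variable {n : ℕ}

theorem nontrivial_Rn (hn : 1 ≤ n) : Nontrivial (Rn n) := by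
  have : Nonempty (Fin n) := ⟨⟨0, hn⟩⟩
  infer_instance

theorem unitSphereArea_ne_zero (hn : 1 ≤ n) : unitSphereArea n ≠ 0 := by
  have := nontrivial_Rn hn
  rw [unitSphereArea, Measure.measure_univ_ne_zero]
  exact Measure.toSphere_ne_zero _

theorem unitSphereArea_ne_top : unitSphereArea n ≠ ∞ := measure_ne_top _ _

theorem lintegral_sphereArea {F : Rn n → ℝ≥0∞} (hF : Measurable F) (t : ℝ) :
    ∫⁻ x, F x ∂(sphereArea 0 t) = ENNReal.ofReal (t ^ (n - 1)) *
      ∫⁻ u : Metric.sphere (0 : Rn n) 1, F (t • (u : Rn n)) ∂volume.toSphere := by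
  rw [sphereArea, lintegral_smul_measure, lintegral_map hF (by fun_prop)]
  simp

theorem lintegral_eq_lintegral_sphereArea (hn : 1 ≤ n) {F : Rn n → ℝ≥0∞} (hF : Measurable F) :
    ∫⁻ x, F x = ∫⁻ t in Ioi (0 : ℝ), ∫⁻ x, F x ∂(sphereArea 0 t) := by
  have := nontrivial_Rn hn
  rw [lintegral_eq_lintegral_Ioi_lintegral_sphere _ hF]
  simp [lintegral_sphereArea hF]

theorem measurable_lintegral_sphereArea {F : Rn n → ℝ≥0∞} (hF : Measurable F) :
    Measurable fun t => ∫⁻ x, F x ∂(sphereArea 0 t) := by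
  simp only [lintegral_sphereArea hF]
  have hg : Measurable fun y : ℝ × Metric.sphere (0 : Rn n) 1 => F (y.1 • (y.2 : Rn n)) :=
    hF.comp (by fun_prop)
  exact Measurable.mul (by fun_prop) hg.lintegral_prod_right'

theorem ae_sphereArea_norm_eq {t : ℝ} (ht : 0 ≤ t) : ∀ᵐ x ∂(sphereArea (0 : Rn n) t), ‖x‖ = t := by
  refine Measure.ae_smul_measure ?_ _
  rw [ae_map_iff (by fun_prop) (measurableSet_eq_fun (by fun_prop) (by fun_prop))]
  exact Eventually.of_forall fun u => by simp [norm_smul, abs_of_nonneg ht]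

/-- A property that holds almost everywhere holds almost everywhere on almost all spheres. -/
theorem ae_ae_sphereArea (hn : 1 ≤ n) {P : Rn n → Prop} (hP : ∀ᵐ x, P x) :
    ∀ᵐ t ∂(volume.restrict (Ioi (0 : ℝ))), ∀ᵐ x ∂(sphereArea 0 t), P x := by
  obtain ⟨N, hPN, hNm, hN⟩ := exists_measurable_superset_of_null hP
  have hF : Measurable (N.indicator (1 : Rn n → ℝ≥0∞)) := measurable_one.indicator hNm
  have h1 := lintegral_eq_lintegral_sphereArea hn hF
  rw [lintegral_indicator_one hNm, hN, eq_comm,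
    lintegral_eq_zero_iff (measurable_lintegral_sphereArea hF)] at h1
  filter_upwards [h1] with t ht
  rw [Pi.zero_apply, lintegral_indicator_one hNm] at ht
  exact measure_mono_null hPN ht

theorem lintegral_sphereArea_le_of_sphericalMean_le (hn : 1 ≤ n) {Q : Rn n → ℝ≥0∞} {t : ℝ}
    (ht : 0 < t) {c : ℝ≥0∞} (h : sphericalMean Q 0 t ≤ c) :
    ∫⁻ x, Q x ∂(sphereArea 0 t) ≤ unitSphereArea n * ENNReal.ofReal (t ^ (n - 1)) * c := by
  have h0 : unitSphereArea n * ENNReal.ofReal (t ^ (n - 1)) ≠ 0 :=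
    mul_ne_zero (unitSphereArea_ne_zero hn) (ENNReal.ofReal_pos.2 (by positivity)).ne'
  have h1 : unitSphereArea n * ENNReal.ofReal (t ^ (n - 1)) ≠ ∞ :=
    ENNReal.mul_ne_top unitSphereArea_ne_top ENNReal.ofReal_ne_top
  exact (ENNReal.inv_mul_le_iff h0 h1).1 h

/-- Polar coordinates need a Borel integrand, so Q is replaced by a Borel representative Q'. The two
agree almost everywhere on almost every sphere in the ring, so the bound on the means of Q applies
to Q'. -/
theorem lintegral_sphericalRing_le (hn : 1 ≤ n) {Q : Rn n → ℝ≥0∞}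
    (hQm : AEMeasurable Q (volume.restrict (Metric.ball 0 1))) {c : ℝ≥0∞} {r₁ r₂ : ℝ}
    (hr₂ : r₂ ≤ 1)
    (hQ : ∀ᵐ t ∂(volume.restrict (Ioo r₁ r₂)), sphericalMean Q 0 t ≤ c) {ψ : ℝ → ℝ≥0∞}
    (hψ : Measurable ψ) :
    ∫⁻ x in sphericalRing 0 r₁ r₂, Q x * ψ ‖x - 0‖ ≤
      c * unitSphereArea n * ∫⁻ t in Ioo r₁ r₂, ENNReal.ofReal (t ^ (n - 1)) * ψ t := by
  obtain ⟨Q', hQ'm, hQQ'⟩ := hQm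
  have hQQ := (ae_restrict_iff' measurableSet_ball).1 hQQ'
  set A : Set (Rn n) := sphericalRing 0 r₁ r₂ with hA
  have hAmem : ∀ x, x ∈ A ↔ ‖x‖ ∈ Ioo r₁ r₂ := fun x => by simp [hA, sphericalRing]
  have hAm : MeasurableSet A := by
    have : A = (fun x : Rn n => ‖x‖) ⁻¹' Ioo r₁ r₂ := by ext x; simp [hAmem]
    rw [this]
    exact measurable_norm measurableSet_Ioo
  have hAball : ∀ x ∈ A, x ∈ Metric.ball (0 : Rn n) 1 := fun x hx => by
    rw [mem_ball_zero_iff]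
    exact ((hAmem x).1 hx).2.trans_le hr₂
  have hFm : Measurable (A.indicator fun x => Q' x * ψ ‖x‖) :=
    (hQ'm.mul (hψ.comp measurable_norm)).indicator hAm
  have h1 : ∫⁻ x in A, Q x * ψ ‖x - 0‖ = ∫⁻ x, A.indicator (fun x => Q' x * ψ ‖x‖) x := by
    rw [lintegral_indicator hAm]
    refine lintegral_congr_ae ((ae_restrict_iff' hAm).2 ?_)
    filter_upwards [hQQ] with x hx hxA
    rw [hx (hAball x hxA), sub_zero]
  rw [h1, lintegral_eq_lintegral_sphereArea hn hFm, ← lintegral_const_mul _ (by fun_prop),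
    ← lintegral_indicator measurableSet_Ioi, ← lintegral_indicator measurableSet_Ioo]
  refine lintegral_mono_ae ?_
  filter_upwards [(ae_restrict_iff' measurableSet_Ioi).1 (ae_ae_sphereArea hn hQQ),
    (ae_restrict_iff' measurableSet_Ioo).1 hQ] with t ht1 ht2
  by_cases ht0 : t ∈ Ioi (0 : ℝ)
  swap
  · rw [indicator_of_notMem ht0]
    exact zero_le
  rw [indicator_of_mem ht0]
  have hnorm := ae_sphereArea_norm_eq (n := n) (le_of_lt ht0)
  by_cases ht : t ∈ Ioo r₁ r₂
  · rw [indicator_of_mem ht]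
    have h2 : ∫⁻ x, A.indicator (fun x => Q' x * ψ ‖x‖) x ∂(sphereArea 0 t) =
        ∫⁻ x, Q' x * ψ t ∂(sphereArea 0 t) := by
      refine lintegral_congr_ae ?_
      filter_upwards [hnorm] with x hx
      rw [indicator_of_mem ((hAmem x).2 (hx ▸ ht)), hx]
    have h3 : ∫⁻ x, Q' x ∂(sphereArea 0 t) = ∫⁻ x, Q x ∂(sphereArea 0 t) := by
      refine lintegral_congr_ae ?_
      filter_upwards [hnorm, ht1 ht0] with x hx hx'
      exact (hx' (hAball x ((hAmem x).2 (hx ▸ ht)))).symm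
    rw [h2, lintegral_mul_const _ hQ'm, h3]
    calc (∫⁻ x, Q x ∂(sphereArea 0 t)) * ψ t
        ≤ (unitSphereArea n * ENNReal.ofReal (t ^ (n - 1)) * c) * ψ t := by
          gcongr
          exact lintegral_sphereArea_le_of_sphericalMean_le hn ht0 (ht2 ht)
      _ = _ := by ring
  · have h2 : ∫⁻ x, A.indicator (fun x => Q' x * ψ ‖x‖) x ∂(sphereArea 0 t) = 0 := by
      rw [← lintegral_zero (μ := sphereArea (0 : Rn n) t)]
      refine lintegral_congr_ae ?_
      filter_upwards [hnorm] with x hx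
      rw [indicator_of_notMem fun h => ht (hx ▸ (hAmem x).1 h)]
    rw [h2]
    exact zero_le

end UpperBound

/-! ### Comparison of the two bounds. -/

section Distortion

variable {n : ℕ}

/-- If `f` maps the sphere of radius `r₂` into the closed ball of radius `b`, the curves joining the
images of two spheres contain radial segments in all directions. -/
theorem le_pModulus_joiningCurves (hn : 1 ≤ n) {p : ℝ} (hp : (n : ℝ) < p) {f : Rn n → Rn n}
    (hf : IsEmbedding ((Metric.ball (0 : Rn n) 1).domRestrict f)) (hf0 : f 0 = 0) {r₁ r₂ b : ℝ}
    (hr₁ : 0 < r₁) (hr : r₁ < r₂) (hr₂ : r₂ < 1) (hb : 0 < b) (hfb : ∀ x, ‖x‖ = r₂ → ‖f x‖ ≤ b) :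
    ENNReal.ofReal (((p - n) / (p - 1)) ^ (p - 1) * b ^ ((n : ℝ) - p)) * unitSphereArea n ≤
      pModulus p (joiningCurves (f '' Metric.sphere 0 r₁) (f '' Metric.sphere 0 r₂)
        (f '' Metric.ball 0 1)) := by
  have := nontrivial_Rn hn
  have hsub : Metric.closedBall (0 : Rn n) r₂ ⊆ Metric.ball 0 1 :=
    Metric.closedBall_subset_ball hr₂
  have hfc : ContinuousOn f (Metric.closedBall 0 r₂) :=
    (continuousOn_iff_continuous_domRestrict.2 hf.continuous).mono hsub
  have hfi : InjOn f (Metric.closedBall 0 r₂) := (injOn_iff_injective.2 hf.injective).mono hsub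
  refine le_pModulus_of_forall_radialCurve_mem hn hp hb fun u hu => ?_
  obtain ⟨s₁, s₂, h0, hs, h1, h2, h3⟩ := exists_radial_segment hr₁ hr hfc hfi hf0 hu
  refine ⟨s₁, s₂, hs, h0, ?_, h1, h2, fun t ht =>
    image_mono (Metric.ball_subset_closedBall.trans hsub) (h3 t ht)⟩
  obtain ⟨x, hx, hxs⟩ := h2
  have h4 := hfb x (mem_sphere_zero_iff_norm.1 hx)
  rwa [hxs, norm_smul, hu, mul_one, Real.norm_of_nonneg (h0.trans hs).le] at h4

/-- The upper bound for the modulus given by the extremal metric `t ^ (-(n - 1) / (p - 1))`. -/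
theorem pModulus_joiningCurves_le (hn : 1 ≤ n) {p : ℝ} (hp : (n : ℝ) < p) {Q : Rn n → ℝ≥0∞}
    {f : Rn n → Rn n} (hf : IsRingQHomeomorphism p (Metric.ball (0 : Rn n) 1) Q 0 f) {q₀ ε₀ : ℝ}
    (hq₀ : 0 < q₀) (hε₀ : ε₀ ≤ 1)
    (hQ : ∀ᵐ t ∂(volume.restrict (Ioo 0 ε₀)), sphericalMean Q 0 t ≤ ENNReal.ofReal q₀) {r₁ r₂ : ℝ}
    (hr₁ : 0 < r₁) (hr : r₁ < r₂) (hr₂ : r₂ < ε₀) :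
    pModulus p (joiningCurves (f '' Metric.sphere 0 r₁) (f '' Metric.sphere 0 r₂)
        (f '' Metric.ball 0 1)) ≤
      ENNReal.ofReal (q₀ * ((r₂ ^ ((p - n) / (p - 1)) - r₁ ^ ((p - n) / (p - 1))) /
        ((p - n) / (p - 1))) ^ (1 - p)) * unitSphereArea n := by
  have := nontrivial_Rn hn
  have hn' : (1 : ℝ) ≤ n := by exact_mod_cast hn
  have hp1 : 0 < p - 1 := by linarith
  set α := (p - n) / (p - 1) with hα
  have hα0 : 0 < α := div_pos (by linarith) hp1
  set I := (r₂ ^ α - r₁ ^ α) / α with hI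
  have hI0 : 0 < I := div_pos (sub_pos.2 (Real.rpow_lt_rpow hr₁.le hr hα0)) hα0
  have hIint : ∫⁻ t in Ioo r₁ r₂, ENNReal.ofReal (t ^ (α - 1)) = ENNReal.ofReal I := by
    rw [Measure.restrict_congr_set Ioo_ae_eq_Ioc, lintegral_Ioc_rpow (by linarith) hr₁.le hr.le,
      sub_add_cancel]
  set J := (ENNReal.ofReal I)⁻¹ with hJ
  have hI1 : ENNReal.ofReal I ≠ 0 := (ENNReal.ofReal_pos.2 hI0).ne'
  set η : ℝ → ℝ≥0∞ := fun t => J * ENNReal.ofReal (t ^ (α - 1)) with hη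
  have hηm : Measurable η := by fun_prop
  have hη1 : ∫⁻ t in Ioo r₁ r₂, η t = 1 := by
    rw [lintegral_const_mul _ (by fun_prop), hIint, hJ, ENNReal.inv_mul_cancel hI1
      ENNReal.ofReal_ne_top]
  have hdist : ENNReal.ofReal r₂ < Metric.infEDist (0 : Rn n) (frontier (Metric.ball 0 1)) := by
    refine lt_of_lt_of_le (ENNReal.ofReal_lt_one.2 (hr₂.trans_le hε₀)) (Metric.le_infEDist.2 ?_)
    intro y hy
    rw [frontier_ball _ one_ne_zero, mem_sphere_iff_norm, sub_zero] at hy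
    rw [edist_dist, dist_zero_left, hy, ENNReal.ofReal_one]
  have hup := hf.modulus_le r₁ r₂ hr₁ hr hdist η hηm.aemeasurable hη1
  have hring := lintegral_sphericalRing_le hn hf.measurable (hr₂.le.trans hε₀)
    (ae_restrict_of_ae_restrict_of_subset (Ioo_subset_Ioo hr₁.le hr₂.le) hQ)
    (ψ := fun t => η t ^ p) (hηm.pow_const p)
  have hint : ∫⁻ t in Ioo r₁ r₂, ENNReal.ofReal (t ^ (n - 1)) * η t ^ p =
      ENNReal.ofReal (I ^ (1 - p)) := by
    -- By this identity t^{n-1} η^p is a multiple of t^{α-1} again, and the integral is I^{-p} I =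
    -- I^{1-p}.
    have he : (n : ℝ) - 1 + (α - 1) * p = α - 1 := by
      rw [hα]
      field_simp
      ring
    have h1 : ∫⁻ t in Ioo r₁ r₂, ENNReal.ofReal (t ^ (n - 1)) * η t ^ p =
        ∫⁻ t in Ioo r₁ r₂, J ^ p * ENNReal.ofReal (t ^ (α - 1)) := by
      refine setLIntegral_congr_fun measurableSet_Ioo fun t ht => ?_
      have ht0 : 0 < t := hr₁.trans ht.1
      have hp0 : 0 ≤ p := by linarith
      simp only [hη]
      rw [ENNReal.mul_rpow_of_nonneg _ _ hp0,
        ENNReal.ofReal_rpow_of_nonneg (Real.rpow_nonneg ht0.le _) hp0, mul_left_comm,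
        ← ENNReal.ofReal_mul (by positivity), ← Real.rpow_mul ht0.le, ← Real.rpow_natCast,
        ← Real.rpow_add ht0, Nat.cast_sub hn, Nat.cast_one, he]
    rw [h1, lintegral_const_mul _ (by fun_prop), hIint, hJ, ← ENNReal.ofReal_inv_of_pos hI0,
      ENNReal.ofReal_rpow_of_pos (inv_pos.2 hI0), ← ENNReal.ofReal_mul (by positivity),
      Real.inv_rpow hI0.le, ← Real.rpow_neg hI0.le, sub_eq_neg_add, Real.rpow_add hI0,
      Real.rpow_one]
  rw [hint] at hring
  refine hup.trans (hring.trans (le_of_eq ?_))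
  rw [ENNReal.ofReal_mul hq₀.le]
  ring

theorem rpow_le_of_forall_norm_le (hn : 1 ≤ n) {p : ℝ} (hp : (n : ℝ) < p) {Q : Rn n → ℝ≥0∞}
    {f : Rn n → Rn n} (hf : IsRingQHomeomorphism p (Metric.ball (0 : Rn n) 1) Q 0 f)
    (hf0 : f 0 = 0) {q₀ ε₀ : ℝ} (hq₀ : 0 < q₀) (hε₀ : ε₀ ≤ 1)
    (hQ : ∀ᵐ t ∂(volume.restrict (Ioo 0 ε₀)), sphericalMean Q 0 t ≤ ENNReal.ofReal q₀) {r k : ℝ}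
    (hr : 0 < r) (hrε : r < ε₀) (hk : 0 < k) (hfk : ∀ x, ‖x‖ = r → ‖f x‖ ≤ k * r) :
    k ^ ((n : ℝ) - p) ≤ q₀ := by
  have hn' : (1 : ℝ) ≤ n := by exact_mod_cast hn
  have hp1 : 0 < p - 1 := by linarith
  set α := (p - n) / (p - 1) with hα
  have hα0 : 0 < α := div_pos (by linarith) hp1
  have hineq : ∀ r₁, 0 < r₁ → r₁ < r → α ^ (p - 1) * (k * r) ^ ((n : ℝ) - p) ≤
      q₀ * ((r ^ α - r₁ ^ α) / α) ^ (1 - p) := by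
    intro r₁ h0 h1
    have h2 := (le_pModulus_joiningCurves hn hp hf.homeo hf0 h0 h1 (hrε.trans_le hε₀)
      (mul_pos hk hr) hfk).trans (pModulus_joiningCurves_le hn hp hf hq₀ hε₀ hQ h0 h1 hrε)
    rw [ENNReal.mul_le_mul_iff_left (unitSphereArea_ne_zero hn) unitSphereArea_ne_top] at h2
    refine (ENNReal.ofReal_le_ofReal_iff ?_).1 h2
    have : 0 ≤ r ^ α - r₁ ^ α := sub_nonneg.2 (Real.rpow_le_rpow h0.le h1.le hα0.le)
    positivity
  have hrα : 0 < r ^ α := Real.rpow_pos_of_pos hr _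
  -- Since α > 0, the inner radius drops out in the limit; what is left is homogeneous in r, with
  -- α(1-p) = n-p on both sides.
  have hlim : Tendsto (fun r₁ : ℝ => q₀ * ((r ^ α - r₁ ^ α) / α) ^ (1 - p)) (𝓝[>] 0)
      (𝓝 (q₀ * ((r ^ α - 0 ^ α) / α) ^ (1 - p))) := by
    have h1 : Tendsto (fun r₁ : ℝ => r₁ ^ α) (𝓝[>] 0) (𝓝 (0 ^ α)) :=
      ((Real.continuous_rpow_const hα0.le).tendsto 0).mono_left nhdsWithin_le_nhds
    refine Tendsto.const_mul _ (((tendsto_const_nhds.sub h1).div_const α).rpow_const (Or.inl ?_))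
    rw [Real.zero_rpow hα0.ne', sub_zero]
    positivity
  have hle := ge_of_tendsto hlim (by
    filter_upwards [Ioo_mem_nhdsGT hr] with r₁ h1
    exact hineq r₁ h1.1 h1.2)
  rw [Real.zero_rpow hα0.ne', sub_zero, Real.div_rpow hrα.le hα0.le, ← Real.rpow_mul hr.le,
    Real.mul_rpow hk.le hr.le] at hle
  have he1 : α * (1 - p) = n - p := by
    rw [hα]
    field_simp
    ring
  have he2 : α ^ (1 - p) = (α ^ (p - 1))⁻¹ := by rw [← Real.rpow_neg hα0.le, neg_sub]
  rw [he1, he2, div_inv_eq_mul] at hle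
  have h3 : 0 < r ^ ((n : ℝ) - p) * α ^ (p - 1) := by positivity
  refine le_of_mul_le_mul_right ?_ h3
  linarith

end Distortion

/-! ### The bound for the upper limit. -/

theorem corollary2 (n : ℕ) (hn : 2 ≤ n) (p : ℝ) (hp : (n : ℝ) < p)
    (Q : Rn n → ℝ≥0∞) (f : Rn n → Rn n)
    (hf : IsRingQHomeomorphism p (Metric.ball (0 : Rn n) 1) Q 0 f) (hf0 : f 0 = 0)
    (q₀ : ℝ) (hq₀ : 0 < q₀) (ε₀ : ℝ) (hε₀ : ε₀ ∈ Ioo (0 : ℝ) 1)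
    (hQ : ∀ᵐ t ∂(volume.restrict (Ioo 0 ε₀)), sphericalMean Q 0 t ≤ ENNReal.ofReal q₀) :
    ((q₀ ^ (1 / ((n : ℝ) - p)) : ℝ) : EReal) ≤
      limsup (fun x : Rn n => ((‖f x‖ / ‖x‖ : ℝ) : EReal)) (𝓝[≠] 0) := by
  by_contra hlt
  rw [not_le] at hlt
  obtain ⟨k₀, hk₀, hk₀'⟩ := EReal.lt_iff_exists_real_btwn.1 hlt
  rw [EReal.coe_lt_coe_iff] at hk₀'
  set K := q₀ ^ (1 / ((n : ℝ) - p)) with hK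
  have hK0 : 0 < K := Real.rpow_pos_of_pos hq₀ _
  -- The separating number k₀ need not be positive; the maximum with K / 2 is, and is still below K.
  set k := max k₀ (K / 2) with hk
  have hk0 : 0 < k := lt_max_of_lt_right (by linarith)
  have hkK : k < K := max_lt hk₀' (by linarith)
  have hev := eventually_lt_of_limsup_lt hk₀
  rw [eventually_nhdsWithin_iff, Metric.eventually_nhds_iff] at hev
  obtain ⟨δ, hδ, hδf⟩ := hev
  set r := min δ ε₀ / 2 with hr
  have hmin : 0 < min δ ε₀ := lt_min hδ hε₀.1
  have hr0 : 0 < r := half_pos hmin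
  have hrmin : r < min δ ε₀ := half_lt_self hmin
  have h1 : k ^ ((n : ℝ) - p) ≤ q₀ := by
    refine rpow_le_of_forall_norm_le (by omega) hp hf hf0 hq₀ hε₀.2.le hQ hr0
      (hrmin.trans_le (min_le_right _ _)) hk0 fun x hx => ?_
    have hx0 : x ≠ 0 := by
      rintro rfl
      rw [norm_zero] at hx
      exact hr0.ne hx
    have h2 := hδf (y := x) (by
      rw [dist_zero_right, hx]; exact hrmin.trans_le (min_le_left _ _)) hx0
    rw [EReal.coe_lt_coe_iff, hx, div_lt_iff₀ hr0] at h2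
    exact h2.le.trans (by gcongr; exact le_max_left _ _)
  have hnp : (n : ℝ) - p < 0 := by linarith
  have h2 : K ^ ((n : ℝ) - p) = q₀ := by
    rw [hK, ← Real.rpow_mul hq₀.le, one_div_mul_cancel hnp.ne, Real.rpow_one]
  -- The negative exponent reverses k < K into q₀ = K^{n-p} < k^{n-p}.
  have h3 := Real.rpow_lt_rpow_of_neg hk0 hkK hnp
  linarith
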